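/- Let $G$ be a $\sigma$-compact (finite-dimensional, real) Lie group acting on an oriented smooth $n$-manifold $X$ (without boundary, Hausdorff and second countable, so that $X$ with its Borel $\sigma$-algebra is a standard Borel space). Let $\mu$ be a Borel probability measure on $X$ given by a nowhere-vanishing volume form. Suppose that there is a closed set $X_0\subseteq X$ which is a union of $G$-orbits, such that (i) $\mu(X_0)=0$; (ii) the action of $G$ on $X\setminus X_0$ is free and smooth, the latter meaning that $G\times(X\setminus X_0)\to X\setminus X_0$, $(g,x)\mapsto gx$, is a smooth map; (iii) the orbit space $(X\setminus X_0)/G$ with the quotient topology is a (Hausdorff) manifold which can be equipped with a smooth structure such that the quotient map $X\setminus X_0\to (X\setminus X_0)/G$ is a submersion. Then $(X,\mu)$ is orbit-regular under the action of $G$, that is: there is a closed set $X_0\subseteq X$ which is a union of $G$-orbits with $\mu(X_0)=0$, such that $G$ acts freely on $X\setminus X_0$ and, with $\pi:X\setminus X_0\to Y=(X\setminus X_0)/G$ the quotient map, $Y$ carrying the Borel $\sigma$-algebra of the quotient topology, and $\nu=\pi_*(\mu|_{X\setminus X_0})$, there is a disintegration $(\mu_y)_{y\in Y}$ of $\mu|_{X\setminus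 X_0}$ over $\nu$ such that for every $y\in Y$ the measure $\mu_y$ and the left-invariant measure on the orbit $\pi^{-1}(y)$ (the image of a left Haar measure of $G$ under $g\mapsto gx$, for any $x\in\pi^{-1}(y)$) are mutually absolutely continuous. Here a disintegration means that every $\mu_y$ is a Radon measure on $X\setminus X_0$; that for $\nu$-almost all $y$ it is a probability measure with $\mu_y\big((X\setminus X_0)\setminus\pi^{-1}(y)\big)=0$; and that for every measurable $g:X\setminus X_0\to[0,\infty]$ the function $y\mapsto\int_{\pi^{-1}(y)}g\,d\mu_y$ is $\nu$-measurable and $\int_{X\setminus X_0} g\,d\mu=\int_Y\int_{\pi^{-1}(y)}g(x)\,\mu_y(dx)\,\nu(dy)$. -/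

import Mathlib

open MeasureTheory
open scoped Manifold ContDiff

noncomputable section

section VolumeForms

/-- The model space `ℝⁿ`. -/
abbrev RSpace (n : ℕ) : Type := EuclideanSpace ℝ (Fin n)

variable (n : ℕ) (X : Type*) [TopologicalSpace X] [ChartedSpace (RSpace n) X]

/-- An orientation of a smooth `n`-manifold, as an oriented atlas: a family of smooth charts which
covers `X` and whose transition maps have positive Jacobian determinant. -/
structure OrientedAtlas where
  charts : Set (OpenPartialHomeomorph X (RSpace n))
  subset_maximalAtlas : charts ⊆ IsManifold.maximalAtlas (𝓡 n) ∞ X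
  covers : ∀ x : X, ∃ φ ∈ charts, x ∈ φ.source
  det_pos : ∀ φ ∈ charts, ∀ ψ ∈ charts, ∀ y ∈ φ.target, φ.symm y ∈ ψ.source →
    0 < (fderiv ℝ (fun z => ψ (φ.symm z)) y).det

variable {n X}

/-- The coefficient of the `n`-form `η` in the chart `φ`: the function `c` on the target of `φ`
such that `η = c dx₁ ∧ ⋯ ∧ dxₙ`, that is `c = η (∂/∂x₁, …, ∂/∂xₙ)`. -/
def formCoeff (η : (x : X) → (TangentSpace (𝓡 n) x) [⋀^Fin n]→ₗ[ℝ] ℝ)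
    (φ : OpenPartialHomeomorph X (RSpace n)) (y : RSpace n) : ℝ :=
  η (φ.symm y) fun i =>
    mfderiv (𝓡 n) (𝓡 n) φ.symm y (EuclideanSpace.single i (1 : ℝ) : RSpace n)

variable (n X)

/-- A volume form: a smooth nowhere-vanishing differential `n`-form on a smooth `n`-manifold. -/
structure VolumeForm where
  form : (x : X) → (TangentSpace (𝓡 n) x) [⋀^Fin n]→ₗ[ℝ] ℝ
  smooth : ∀ φ ∈ IsManifold.maximalAtlas (𝓡 n) ∞ X,
    ContDiffOn ℝ ∞ (formCoeff form φ) φ.target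
  nowhere_vanishing : ∀ x : X, form x ≠ 0

variable {n X}

/-- The measure `μ` is given by the volume form `η`: for every oriented chart `φ` and every Borel
set `A` in its domain, `μ(A)` is the integral over `φ(A)` of the coefficient of `η`.
The absolute value makes no difference when `η` is positive for the orientation, which is the case
where `A ↦ ∫_A η` is a (positive) measure. -/
def IsGivenByVolumeForm [MeasurableSpace X] (O : OrientedAtlas n X) (η : VolumeForm n X)
    (μ : Measure X) : Prop :=
  ∀ φ ∈ O.charts, ∀ A : Set X, MeasurableSet A → A ⊆ φ.source →
    μ A = ∫⁻ y in φ '' A, ‖formCoeff η.form φ y‖ₑ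

end VolumeForms

section Orbits

variable (G X : Type*) [Group G] [MulAction G X] [TopologicalSpace X]

/-- A closed subset `X₀` of `X` which is a union of orbits. -/
structure ClosedOrbitUnion where
  carrier : Set X
  isClosed : IsClosed carrier
  isUnion : ∃ A : Set X, carrier = ⋃ x ∈ A, MulAction.orbit G x

namespace ClosedOrbitUnion

variable {G X} (Z : ClosedOrbitUnion G X)

/-- `X ∖ X₀`, as an open subset of `X`. -/
def compl : TopologicalSpace.Opens X := ⟨Z.carrierᶜ, Z.isClosed.isOpen_compl⟩

theorem smul_mem_compl (g : G) {x : X} (hx : x ∈ Z.compl) : g • x ∈ Z.compl := by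
  obtain ⟨A, hA⟩ := Z.isUnion
  intro h
  apply hx
  rw [hA] at h ⊢
  simp only [Set.mem_iUnion] at h ⊢
  obtain ⟨a, ha, h⟩ := h
  exact ⟨a, ha, by simpa using MulAction.mem_orbit_of_mem_orbit g⁻¹ h⟩

/-- The action of `G` on `X` restricts to `X ∖ X₀`. -/
instance : MulAction G Z.compl where
  smul g x := ⟨g • (x : X), Z.smul_mem_compl g x.2⟩
  one_smul x := Subtype.ext (one_smul G (x : X))
  mul_smul g h x := Subtype.ext (mul_smul g h (x : X))

/-- `G` acts freely on `X ∖ X₀`. -/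
def ActsFreely : Prop := ∀ (g : G) (x : Z.compl), g • x = x → g = 1

/-- The orbit space `(X ∖ X₀) / G`. -/
def OrbitSpace : Type _ := MulAction.orbitRel.Quotient G Z.compl

/-- The quotient map `X ∖ X₀ → (X ∖ X₀) / G`. -/
def proj (x : Z.compl) : Z.OrbitSpace := Quotient.mk (MulAction.orbitRel G Z.compl) x

/-- The quotient topology. -/
instance : TopologicalSpace Z.OrbitSpace :=
  TopologicalSpace.coinduced Z.proj inferInstance

/-- The Borel `σ`-algebra of the quotient topology. -/
instance : MeasurableSpace Z.OrbitSpace := borel _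

instance : BorelSpace Z.OrbitSpace := ⟨rfl⟩

/-- `(X ∖ X₀) / G` is a (Hausdorff) manifold which can be equipped with a smooth structure such that
the quotient map is a submersion. Second countability is automatic for a quotient of this kind. -/
def QuotientIsSmooth {n : ℕ} [ChartedSpace (RSpace n) X] : Prop :=
  T2Space Z.OrbitSpace ∧
    ∃ (m : ℕ) (_ : ChartedSpace (RSpace m) Z.OrbitSpace),
      IsManifold (𝓡 m) ∞ Z.OrbitSpace ∧
        Manifold.IsSubmersion (𝓡 n) (𝓡 m) ∞ Z.proj

end ClosedOrbitUnion

end Orbits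

section OrbitRegular

/-- The family `κ` is a disintegration of `μ` over `ν` with respect to `f`: `f` is
inverse-measure-preserving, every `κ y` is a Radon measure, for almost every `y` it is a probability
measure for which the fibre over `y` is conegligible, and
`∫ g dμ = ∫ (∫_{f⁻¹(y)} g dκ_y) dν(y)` for measurable `g ≥ 0` (hence, by taking positive and
negative parts, for all measurable `g` for which `∫ g dμ` is defined). -/
structure IsDisintegration {X Y : Type*} [TopologicalSpace X] [MeasurableSpace X]
    [MeasurableSpace Y] (f : X → Y) (μ : Measure X) (ν : Measure Y) (κ : Y → Measure X) :
    Prop where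
  measurePreserving : MeasurePreserving f μ ν
  isLocallyFinite : ∀ y, IsLocallyFiniteMeasure (κ y)
  innerRegular : ∀ y, (κ y).InnerRegular
  conegligible : ∀ᵐ y ∂ν, IsProbabilityMeasure (κ y) ∧ κ y (f ⁻¹' {y})ᶜ = 0
  aemeasurable : ∀ g : X → ENNReal, Measurable g →
    AEMeasurable (fun y => ∫⁻ x in f ⁻¹' {y}, g x ∂(κ y)) ν
  lintegral_eq : ∀ g : X → ENNReal, Measurable g →
    ∫⁻ x, g x ∂μ = ∫⁻ y, ∫⁻ x in f ⁻¹' {y}, g x ∂(κ y) ∂ν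

/-- The left-invariant measure on the orbit of `x`: the left Haar measure of `G` transported by the
orbit map `g ↦ g • x`. -/
def orbitHaar (G : Type*) {X : Type*} [Group G] [TopologicalSpace G] [IsTopologicalGroup G]
    [LocallyCompactSpace G] [MeasurableSpace G] [BorelSpace G] [MulAction G X]
    [MeasurableSpace X] (x : X) : Measure X :=
  (Measure.haar : Measure G).map fun g => g • x

/-- The standard Borel probability space `(X, μ)` is orbit-regular under the action of the locally
compact `σ`-compact group `G`: off a closed null union of orbits `X₀` the action is free, and the
restriction of `μ` to `X ∖ X₀` has a disintegration over the orbit space `(X ∖ X₀) / G` whose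
measures are equivalent to the left-invariant measures on the respective orbits. -/
def OrbitRegular (G : Type*) {X : Type*} [Group G] [TopologicalSpace G] [IsTopologicalGroup G]
    [LocallyCompactSpace G] [SigmaCompactSpace G] [MeasurableSpace G] [BorelSpace G]
    [TopologicalSpace X] [PolishSpace X] [MeasurableSpace X] [BorelSpace X] [MulAction G X]
    (μ : Measure X) [IsProbabilityMeasure μ] : Prop :=
  ∃ Z : ClosedOrbitUnion G X, μ Z.carrier = 0 ∧ Z.ActsFreely ∧
    ∃ κ : Z.OrbitSpace → Measure Z.compl,
      IsDisintegration Z.proj (μ.comap (Subtype.val : Z.compl → X))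
        ((μ.comap (Subtype.val : Z.compl → X)).map Z.proj) κ ∧
      ∀ x : Z.compl, κ (Z.proj x) ≪ orbitHaar G x ∧ orbitHaar G x ≪ κ (Z.proj x)

end OrbitRegular

end

/-! The submersion `Z.proj` has continuous local sections, and countably many of them glue to a
measurable section s. As the action off X₀ is free, (g, y) ↦ g • s y is a Borel isomorphism from G ×
Y, under which the action becomes left translation and `Z.proj` the second projection. Each g acts
smoothly off X₀ and μ has a nowhere-vanishing density in charts, so translation by g preserves
μ-null sets.

A finite measure on G × Y whose null sets are left-invariant has the same null sets as Haar measure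
times its marginal (`measure_eq_zero_iff_prod_snd_eq_zero`, by Fubini). Hence its Radon–Nikodym
density ρ is positive almost everywhere, and the measures ρ(·, y) · Haar, pushed to the orbits,
disintegrate μ. On the null set of bad y, a finite measure equivalent to Haar is substituted, so
that equivalence holds for every y. -/

section QuasiInvariant

variable {G Y : Type*} [Group G] [MeasurableSpace G] [MeasurableMul₂ G] [MeasurableInv G]
  [MeasurableSpace Y]

/-- A null set of a measure on `G × Y` whose null sets are preserved by left translations is a
null set of the product of a left-invariant measure on `G` with the marginal on `Y`, and
conversely. -/
theorem measure_eq_zero_iff_prod_snd_eq_zero (m : Measure G) [SFinite m] [m.IsMulLeftInvariant]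
    [NeZero m] (lam : Measure (G × Y)) [IsFiniteMeasure lam]
    (hlam : ∀ (g : G) (E : Set (G × Y)), MeasurableSet E → lam E = 0 →
      lam ((fun p : G × Y => (g * p.1, p.2)) ⁻¹' E) = 0)
    {E : Set (G × Y)} (hE : MeasurableSet E) :
    lam E = 0 ↔ (m.prod lam.snd) E = 0 := by
  have hmeas : Measurable fun q : G × (G × Y) => (q.1 * q.2.1, q.2.2) := by fun_prop
  -- By quasi-invariance all translates of `E` are null as soon as one is, so averaging over `g`
  -- loses nothing and makes Fubini applicable.
  have h1 : lam E = 0 ↔ ∀ᵐ g ∂m, ∀ᵐ p ∂lam, (g * p.1, p.2) ∉ E := by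
    have h0 : ∀ g : G, (∀ᵐ p ∂lam, (g * p.1, p.2) ∉ E) ↔
        lam ((fun p : G × Y => (g * p.1, p.2)) ⁻¹' E) = 0 := by
      intro g
      simp [ae_iff, Set.preimage]
    simp only [h0]
    constructor
    · intro h
      exact Filter.Eventually.of_forall fun g => hlam g E hE h
    · intro h
      obtain ⟨g, hg⟩ := h.exists
      have hm : Measurable fun p : G × Y => (g * p.1, p.2) := by fun_prop
      have := hlam g⁻¹ _ (hm hE) hg
      simpa [Set.preimage_preimage] using this
  have hE' : MeasurableSet {q : G × (G × Y) | (q.1 * q.2.1, q.2.2) ∉ E} := hmeas hE.compl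
  rw [h1, Measure.ae_ae_comm hE']
  -- The set of `g` here is a right translate of a slice of `E`. Right translation preserves the
  -- null sets of a left-invariant measure, so only `p.2` matters and `lam` may be replaced by its
  -- marginal.
  have h2 : ∀ p : G × Y, (∀ᵐ g ∂m, (g * p.1, p.2) ∉ E) ↔ ∀ᵐ g ∂m, (g, p.2) ∉ E := by
    intro p
    rw [ae_iff, ae_iff]
    exact measure_mul_right_null m (s := {g | ¬(g, p.2) ∉ E}) p.1
  simp only [h2]
  have h3 : MeasurableSet {y : Y | ∀ᵐ g ∂m, (g, y) ∉ E} := by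
    have := measurable_measure_prodMk_right (μ := m) hE (measurableSet_singleton 0)
    convert this using 1
    ext y
    simp [ae_iff, Set.preimage]
  have h4 : (∀ᵐ p ∂lam, ∀ᵐ g ∂m, (g, p.2) ∉ E) ↔ ∀ᵐ y ∂lam.snd, ∀ᵐ g ∂m, (g, y) ∉ E := by
    rw [Measure.snd, ae_map_iff measurable_snd.aemeasurable h3]
  have h5 : MeasurableSet {q : Y × G | (q.2, q.1) ∉ E} := measurable_swap hE.compl
  rw [h4, Measure.ae_ae_comm h5, ← Measure.ae_prod_iff_ae_ae hE.compl]
  simp [ae_iff]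

end QuasiInvariant

section PolishGroup

/-- Local compactness makes the right uniformity complete, and a countable neighbourhood basis at 1
makes it countably generated, hence metrizable. -/
theorem polishSpace_of_locallyCompact_group (G : Type*) [Group G] [TopologicalSpace G]
    [IsTopologicalGroup G] [LocallyCompactSpace G] [T2Space G] [SecondCountableTopology G] :
    PolishSpace G := by
  let _ : UniformSpace G := IsTopologicalGroup.rightUniformSpace G
  have : IsRightUniformGroup G := ⟨rfl⟩
  have : CompleteSpace G := IsRightUniformGroup.completeSpace_of_weaklyLocallyCompactSpace
  have : (uniformity G).IsCountablyGenerated := by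
    rw [uniformity_eq_comap_mul_inv_nhds_one]
    infer_instance
  infer_instance

end PolishGroup

/-! ### Product structure from a section; conditional densities. -/

section AbstractDisintegration

/-- A measurable section of an invariant map whose fibres are the orbits of a free action
identifies the space with the product of the group and the base. -/
theorem exists_measurableEquiv_prod_of_section {G M Y : Type*} [Group G] [MeasurableSpace G]
    [StandardBorelSpace G] [MeasurableSpace M] [StandardBorelSpace M] [MulAction G M]
    (hact : Measurable fun p : G × M => p.1 • p.2) [MeasurableSpace Y] {f : M → Y}
    (hf : Measurable f) {s : Y → M} (hs : Measurable s) (hfs : ∀ y, f (s y) = y)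
    (hinv : ∀ (g : G) x, f (g • x) = f x) (horb : ∀ x, ∃ g : G, g • s (f x) = x)
    (hfree : ∀ (g : G) (x : M), g • x = x → g = 1) :
    StandardBorelSpace Y ∧ ∃ e : G × Y ≃ᵐ M, ∀ p, e p = p.1 • s p.2 := by
  have hrange : MeasurableSet (Set.range s) := by
    -- The range is the fixed-point set of `s ∘ f`, hence Borel; this makes `Y` a copy of a Borel
    -- subset of `M`.
    have : Set.range s = {x | s (f x) = x} := by
      ext x
      constructor
      · rintro ⟨y, rfl⟩
        simp [hfs]
      · intro h
        exact ⟨f x, h⟩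
    rw [this]
    exact measurableSet_eq_fun (hs.comp hf) measurable_id
  have hemb : MeasurableEmbedding s := MeasurableEmbedding.of_measurable_inverse hs hrange hf hfs
  have : StandardBorelSpace (Set.range s) := hrange.standardBorel
  have hY : StandardBorelSpace Y := by
    let e := hemb.equivRange
    let _ := upgradeStandardBorel (Set.range s)
    let _ : TopologicalSpace Y := TopologicalSpace.induced e inferInstance
    have hB : BorelSpace Y := e.measurableEmbedding.borelSpace ⟨rfl⟩
    have hP : PolishSpace Y := e.toEquiv.polishSpace_induced
    infer_instance
  refine ⟨hY, ?_⟩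
  have hm : Measurable fun p : G × Y => p.1 • s p.2 :=
    hact.comp (measurable_fst.prodMk (hs.comp measurable_snd))
  have hinj : Function.Injective fun p : G × Y => p.1 • s p.2 := by
    rintro ⟨g, y⟩ ⟨h, z⟩ hgh
    have hgh' : g • s y = h • s z := hgh
    have hyz : y = z := by
      have := congrArg f hgh'
      rwa [hinv, hinv, hfs, hfs] at this
    subst hyz
    have := hfree (h⁻¹ * g) (s y) (by rw [mul_smul, hgh', inv_smul_smul])
    rw [inv_mul_eq_one.mp this]
  -- Lusin–Souslin: an injective Borel map between standard Borel spaces has Borel images, so the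
  -- inverse is measurable.
  have hE := hm.measurableEmbedding hinj
  have hsurj : Function.Surjective fun p : G × Y => p.1 • s p.2 := fun x => by
    obtain ⟨g, hg⟩ := horb x
    exact ⟨(g, f x), hg⟩
  refine ⟨⟨Equiv.ofBijective _ ⟨hinj, hsurj⟩, hm, fun E hE' => ?_⟩, fun p => rfl⟩
  rw [← Equiv.image_eq_preimage_symm]
  exact hE.measurableSet_image.2 hE'

variable {G Y : Type*} [Group G] [MeasurableSpace G] [MeasurableMul₂ G] [MeasurableInv G]
  [MeasurableSpace Y]

/-- A finite measure on `G × Y` whose null sets are preserved by left translations has almost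
everywhere positive conditional densities along `G` with respect to a left-invariant measure. -/
theorem exists_conditional_density (m : Measure G) [SigmaFinite m] [m.IsMulLeftInvariant]
    [NeZero m] (lam : Measure (G × Y)) [IsFiniteMeasure lam]
    (hlam : ∀ (g : G) (E : Set (G × Y)), MeasurableSet E → lam E = 0 →
      lam ((fun p : G × Y => (g * p.1, p.2)) ⁻¹' E) = 0) :
    ∃ ρ : G × Y → ENNReal, Measurable ρ ∧ lam = (m.prod lam.snd).withDensity ρ ∧
      ∀ᵐ y ∂lam.snd, (∫⁻ g, ρ (g, y) ∂m = 1) ∧ ∀ᵐ g ∂m, ρ (g, y) ≠ 0 := by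
  have hac : lam ≪ m.prod lam.snd := Measure.AbsolutelyContinuous.mk fun E hE h =>
    (measure_eq_zero_iff_prod_snd_eq_zero m lam hlam hE).2 h
  set ρ := lam.rnDeriv (m.prod lam.snd) with hρ
  have hρm : Measurable ρ := Measure.measurable_rnDeriv _ _
  have hd : (m.prod lam.snd).withDensity ρ = lam := Measure.withDensity_rnDeriv_eq _ _ hac
  refine ⟨ρ, hρm, hd.symm, ?_⟩
  have hint : Measurable fun y => ∫⁻ g, ρ (g, y) ∂m := hρm.lintegral_prod_left'
  -- Integrating `ρ` over G × B returns the marginal mass of B, for every measurable B.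
  have h1 : (fun y => ∫⁻ g, ρ (g, y) ∂m) =ᵐ[lam.snd] fun _ => 1 := by
    refine ae_eq_of_forall_setLIntegral_eq_of_sigmaFinite hint measurable_const fun B hB _ => ?_
    have hB' : MeasurableSet (Prod.snd ⁻¹' B : Set (G × Y)) := measurable_snd hB
    have hpr : (Prod.snd ⁻¹' B : Set (G × Y)) = Set.univ ×ˢ B := by ext; simp
    have : lam.snd B = ∫⁻ y in B, ∫⁻ g, ρ (g, y) ∂m ∂lam.snd := by
      rw [Measure.snd_apply hB]
      conv_lhs => rw [← hd]
      rw [withDensity_apply _ hB', hpr, ← Measure.prod_restrict, Measure.restrict_univ,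
        lintegral_prod_symm' _ hρm]
    simp [← this]
  -- The zero set of `ρ` is trivially `lam`-null; the equivalence of null sets transfers this to the
  -- product measure.
  have h2 : ∀ᵐ p ∂(m.prod lam.snd), ρ p ≠ 0 := by
    have hE : MeasurableSet {p | ρ p = 0} := hρm (measurableSet_singleton 0)
    have h0 : lam {p | ρ p = 0} = 0 := by
      conv_lhs => rw [← hd]
      rw [withDensity_apply _ hE, setLIntegral_congr_fun hE (g := fun _ => 0) fun p hp => hp]
      simp
    rw [ae_iff]
    simpa using (measure_eq_zero_iff_prod_snd_eq_zero m lam hlam hE).1 h0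
  have hne : MeasurableSet {p | ρ p ≠ 0} := (hρm (measurableSet_singleton 0)).compl
  have h3 : ∀ᵐ y ∂lam.snd, ∀ᵐ g ∂m, ρ (g, y) ≠ 0 := by
    rw [Measure.ae_prod_iff_ae_ae hne] at h2
    exact (Measure.ae_ae_comm hne).1 h2
  filter_upwards [h1, h3] with y hy hy' using ⟨hy, hy'⟩

end AbstractDisintegration

/-! ### Disintegration along the orbits of a free action. -/

section FreeAction

variable {G M : Type*} [Group G] [TopologicalSpace G] [IsTopologicalGroup G]
  [LocallyCompactSpace G] [SecondCountableTopology G] [MeasurableSpace G] [BorelSpace G]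
  [MeasurableSpace M] [MulAction G M]

/-- Two points of an orbit have equivalent left-invariant measures. -/
theorem orbitHaar_absolutelyContinuous_smul (hact : Measurable fun p : G × M => p.1 • p.2)
    (h : G) (x : M) :
    orbitHaar G x ≪ orbitHaar G (h • x) ∧ orbitHaar G (h • x) ≪ orbitHaar G x := by
  have hx : ∀ x : M, Measurable fun g : G => g • x := fun x =>
    hact.comp (measurable_id.prodMk measurable_const)
  -- The orbit map of `h • x` is that of `x` after right translation by `h`, which preserves Haar
  -- null sets in both directions.
  have key : orbitHaar G (h • x) =
      ((Measure.haar : Measure G).map (fun g => g * h)).map fun g => g • x := by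
    rw [orbitHaar, Measure.map_map (hx x) (measurable_mul_const h)]
    simp [Function.comp_def, mul_smul]
  rw [key, orbitHaar]
  exact ⟨(absolutelyContinuous_map_mul_right Measure.haar h).map (hx x),
    (quasiMeasurePreserving_mul_right Measure.haar h).absolutelyContinuous.map (hx x)⟩

/-- Disintegration of a quasi-invariant finite measure along the orbits of a free action which
admits a measurable section. -/
theorem exists_isDisintegration_of_section [StandardBorelSpace G] [TopologicalSpace M]
    [PolishSpace M] [BorelSpace M] (hact : Measurable fun p : G × M => p.1 • p.2)
    {Y : Type*} [MeasurableSpace Y] {f : M → Y}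
    (hf : Measurable f) {s : Y → M} (hs : Measurable s) (hfs : ∀ y, f (s y) = y)
    (hinv : ∀ (g : G) x, f (g • x) = f x) (horb : ∀ x, ∃ g : G, g • s (f x) = x)
    (hfree : ∀ (g : G) (x : M), g • x = x → g = 1) (μ : Measure M) [IsFiniteMeasure μ]
    (hμ : ∀ (g : G) (E : Set M), MeasurableSet E → μ E = 0 → μ ((g • ·) ⁻¹' E) = 0) :
    ∃ κ : Y → Measure M, IsDisintegration f μ (μ.map f) κ ∧
      ∀ x, κ (f x) ≪ orbitHaar G x ∧ orbitHaar G x ≪ κ (f x) := by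
  classical
  obtain ⟨hY, e, he⟩ := exists_measurableEquiv_prod_of_section hact hf hs hfs hinv horb hfree
  let m : Measure G := Measure.haar
  have hx : ∀ x : M, Measurable fun g : G => g • x := fun x =>
    hact.comp (measurable_id.prodMk measurable_const)
  set lam := μ.map e.symm with hlam
  have hfe : ∀ p, f (e p) = p.2 := fun p => by rw [he, hinv, hfs]
  have hμlam : μ = lam.map e := by simp [hlam]
  have hsnd : lam.snd = μ.map f := by
    rw [Measure.snd, hlam, Measure.map_map measurable_snd e.symm.measurable]
    congr 1
    ext x
    have := hfe (e.symm x)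
    simp at this
    simp [this]
  have hq : ∀ (g : G) (E : Set (G × Y)), MeasurableSet E → lam E = 0 →
      lam ((fun p : G × Y => (g * p.1, p.2)) ⁻¹' E) = 0 := by
    intro g E hE h0
    rw [hlam, e.symm.map_apply] at h0 ⊢
    have := hμ g _ (e.symm.measurable hE) h0
    convert this using 2
    ext x
    obtain ⟨p, rfl⟩ := e.surjective x
    have : g • e p = e (g * p.1, p.2) := by simp [he, mul_smul]
    simp [this]
  obtain ⟨ρ, hρ, hd, hgood⟩ := exists_conditional_density m lam hq
  rw [hsnd] at hd hgood
  let good : Y → Prop := fun y => (∫⁻ g, ρ (g, y) ∂m = 1) ∧ ∀ᵐ g ∂m, ρ (g, y) ≠ 0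
  -- Equivalence with Haar measure is required at every `y`, but mass one only almost everywhere;
  -- `m.toFinite` is a finite measure equivalent to `m`. Finiteness also yields the Radon property
  -- of `κ y`, since `M` is Polish.
  let θ : Y → Measure G := fun y => if good y then m.withDensity fun g => ρ (g, y) else m.toFinite
  have hρy : ∀ y, Measurable fun g => ρ (g, y) := fun y => hρ.comp (by fun_prop)
  have hθ1 : ∀ y, good y → IsProbabilityMeasure (θ y) := by
    intro y hy
    simp only [θ, if_pos hy]
    exact ⟨by simpa using hy.1⟩
  have hθfin : ∀ y, IsFiniteMeasure (θ y) := by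
    intro y
    by_cases hy : good y
    · have := hθ1 y hy
      infer_instance
    · simp only [θ, if_neg hy]
      infer_instance
  have hθ2 : ∀ y, θ y ≪ m ∧ m ≪ θ y := by
    intro y
    by_cases hy : good y
    · simp only [θ, if_pos hy]
      exact ⟨withDensity_absolutelyContinuous _ _,
        withDensity_absolutelyContinuous' (hρy y).aemeasurable hy.2⟩
    · simp only [θ, if_neg hy]
      exact ⟨toFinite_absolutelyContinuous m, absolutelyContinuous_toFinite m⟩
  let κ : Y → Measure M := fun y => (θ y).map fun g => g • s y
  have hκfin : ∀ y, IsFiniteMeasure (κ y) := fun y => by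
    have := hθfin y
    exact Measure.isFiniteMeasure_map _ _
  have hfib : ∀ y, MeasurableSet (f ⁻¹' {y}) := fun y => hf (measurableSet_singleton y)
  have hκfib : ∀ y, κ y (f ⁻¹' {y})ᶜ = 0 := by
    intro y
    rw [Measure.map_apply (hx _) (hfib y).compl]
    have : (fun g : G => g • s y) ⁻¹' (f ⁻¹' {y})ᶜ = ∅ := by
      ext g
      simp [hinv, hfs]
    rw [this, measure_empty]
  have hκint : ∀ (φ : M → ENNReal), Measurable φ → ∀ y, good y →
      ∫⁻ x in f ⁻¹' {y}, φ x ∂(κ y) = ∫⁻ g, ρ (g, y) * φ (e (g, y)) ∂m := by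
    intro φ hφ y hy
    have hr : (κ y).restrict (f ⁻¹' {y}) = κ y :=
      Measure.restrict_eq_self_of_ae_mem (mem_ae_iff.2 (hκfib y))
    rw [hr, lintegral_map hφ (hx _)]
    simp only [θ, if_pos hy]
    have hφx : Measurable fun g : G => φ (g • s y) := hφ.comp (hx _)
    rw [lintegral_withDensity_eq_lintegral_mul _ (hρy y) hφx]
    simp [he]
  have hφe : ∀ (φ : M → ENNReal), Measurable φ →
      Measurable fun p : G × Y => ρ p * φ (e p) := fun φ hφ => hρ.mul (hφ.comp e.measurable)
  refine ⟨κ, ⟨⟨hf, rfl⟩, fun y => ?_, fun y => ?_, ?_, fun φ hφ => ?_, fun φ hφ => ?_⟩,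
    fun x => ?_⟩
  · have := hκfin y
    infer_instance
  · have := hκfin y
    infer_instance
  · filter_upwards [hgood] with y hy
    have := hθ1 y hy
    exact ⟨Measure.isProbabilityMeasure_map (hx _).aemeasurable, hκfib y⟩
  · refine ⟨fun y => ∫⁻ g, ρ (g, y) * φ (e (g, y)) ∂m, (hφe φ hφ).lintegral_prod_left', ?_⟩
    filter_upwards [hgood] with y hy using hκint φ hφ y hy
  · have h1 : ∫⁻ y, ∫⁻ x in f ⁻¹' {y}, φ x ∂(κ y) ∂(μ.map f) =
        ∫⁻ y, ∫⁻ g, ρ (g, y) * φ (e (g, y)) ∂m ∂(μ.map f) := by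
      refine lintegral_congr_ae ?_
      filter_upwards [hgood] with y hy using hκint φ hφ y hy
    rw [h1, ← lintegral_prod_symm' (fun p : G × Y => ρ p * φ (e p)) (hφe φ hφ)]
    conv_lhs => rw [hμlam]
    rw [lintegral_map hφ e.measurable, hd]
    exact lintegral_withDensity_eq_lintegral_mul _ hρ (hφ.comp e.measurable)
  · obtain ⟨g, hg⟩ := horb x
    have h1 := orbitHaar_absolutelyContinuous_smul hact g (s (f x))
    rw [hg] at h1
    exact ⟨((hθ2 (f x)).1.map (hx _)).trans h1.1, h1.2.trans ((hθ2 (f x)).2.map (hx _))⟩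

end FreeAction

/-! ### Local and measurable sections of submersions. -/

section Sections

open Topology

/-- A submersion has a continuous local section through every point. -/
theorem Manifold.IsSubmersionAt.exists_continuousOn_section {𝕜 : Type*} [NontriviallyNormedField 𝕜]
    {E E' H H' M N : Type*} [NormedAddCommGroup E] [NormedSpace 𝕜 E] [NormedAddCommGroup E']
    [NormedSpace 𝕜 E'] [TopologicalSpace H] [TopologicalSpace H'] [TopologicalSpace M]
    [TopologicalSpace N] [ChartedSpace H M] [ChartedSpace H' N] {I : ModelWithCorners 𝕜 E H}
    {J : ModelWithCorners 𝕜 E' H'} [I.Boundaryless] {r : WithTop ℕ∞} {f : M → N} {x : M}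
    (h : Manifold.IsSubmersionAt I J r f x) :
    ∃ V : Set N, IsOpen V ∧ f x ∈ V ∧ ∃ t : N → M, ContinuousOn t V ∧ ∀ y ∈ V, f (t y) = y := by
  set φ := h.domChart.extend I with hφ
  set ψ := h.codChart.extend J with hψ
  -- In the charts `f` is the first projection of a product; freezing the complementary coordinate
  -- at its value at `x` gives the section.
  let a := (h.equiv (φ x)).2
  let u : N → E := fun y => h.equiv.symm (ψ y, a)
  have hψs : ψ.source = h.codChart.source := h.codChart.extend_source
  have hφs : φ.source = h.domChart.source := h.domChart.extend_source
  have hu : ContinuousOn u h.codChart.source := by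
    refine h.equiv.symm.continuous.comp_continuousOn (ContinuousOn.prodMk ?_ continuousOn_const)
    rw [← hψs]
    exact h.codChart.continuousOn_extend
  have hxφ : x ∈ φ.source := by
    rw [hφs]
    exact h.mem_domChart_source
  refine ⟨h.codChart.source ∩ u ⁻¹' φ.target,
    hu.isOpen_inter_preimage h.codChart.open_source h.domChart.isOpen_extend_target,
    ⟨h.mem_codChart_source, ?_⟩, fun y => φ.symm (u y), ?_, ?_⟩
  · have h1 := h.writtenInCharts (φ.map_source hxφ)
    have h2 : u (f x) = φ x := by
      simp only [Function.comp_apply] at h1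
      rw [← hφ, φ.left_inv hxφ] at h1
      simp only [u, a]
      rw [hψ, h1]
      simp
    rw [Set.mem_preimage, h2]
    exact φ.map_source hxφ
  · exact h.domChart.continuousOn_extend_symm.comp (hu.mono Set.inter_subset_left) fun y hy => hy.2
  · rintro y ⟨hy, hyu⟩
    have h1 := h.writtenInCharts hyu
    simp only [Function.comp_apply] at h1
    have h2 : φ.symm (u y) ∈ h.domChart.source := by
      rw [← hφs]
      exact φ.map_target hyu
    refine ψ.injOn (hψs ▸ h.source_subset_preimage_source h2) (hψs ▸ hy) ?_
    rw [h1]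
    simp [u]

/-- A map onto a second countable space which has continuous local sections has a measurable
section. -/
theorem exists_measurable_section {M N : Type*} [TopologicalSpace M] [MeasurableSpace M]
    [BorelSpace M] [TopologicalSpace N] [SecondCountableTopology N] [MeasurableSpace N]
    [BorelSpace N] (f : M → N)
    (h : ∀ y, ∃ V : Set N, IsOpen V ∧ y ∈ V ∧ ∃ t : N → M,
      ContinuousOn t V ∧ ∀ z ∈ V, f (t z) = z) :
    ∃ s : N → M, Measurable s ∧ ∀ y, f (s y) = y := by
  classical
  rcases isEmpty_or_nonempty N with hN | ⟨⟨y₀⟩⟩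
  · exact ⟨isEmptyElim, measurable_of_empty _, isEmptyElim⟩
  choose V hV hyV t ht hft using h
  obtain ⟨c, hc, hcV⟩ := TopologicalSpace.countable_cover_nhds fun y => (hV y).mem_nhds (hyV y)
  have hcne : c.Nonempty := by
    have : y₀ ∈ ⋃ y ∈ c, V y := hcV ▸ Set.mem_univ y₀
    simp only [Set.mem_iUnion] at this
    obtain ⟨y, hy, _⟩ := this
    exact ⟨y, hy⟩
  obtain ⟨q, rfl⟩ := hc.exists_eq_range hcne
  have hex : ∀ y, ∃ k, y ∈ V (q k) := fun y => by
    have : y ∈ ⋃ y ∈ Set.range q, V y := hcV ▸ Set.mem_univ y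
    simpa using this
  -- The value outside `V (q k)` is immaterial: each `y` uses the first `k` with `y ∈ V (q k)`.
  let T : ℕ → N → M := fun k => (V (q k)).piecewise (t (q k)) fun _ => t y₀ y₀
  have hT : ∀ k, Measurable (T k) := fun k =>
    (ht (q k)).measurable_piecewise continuousOn_const (hV (q k)).measurableSet
  refine ⟨fun y => T (Nat.find (hex y)) y,
    Measurable.find (p := fun k y => y ∈ V (q k)) hT (fun k => (hV (q k)).measurableSet) hex, fun y => ?_⟩
  have hy := Nat.find_spec (hex y)
  simp only [T, Set.piecewise_eq_of_mem _ _ _ hy]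
  exact hft _ _ hy

end Sections

/-! ### Null sets of a volume form under differentiable maps. -/

section NullSets

open Topology

theorem ContinuousOn.measurableSet_inter_preimage {α β : Type*} [TopologicalSpace α]
    [MeasurableSpace α] [OpensMeasurableSpace α] [TopologicalSpace β] [MeasurableSpace β]
    [BorelSpace β] {f : α → β} {s : Set α} (hf : ContinuousOn f s) (hs : MeasurableSet s)
    {A : Set β} (hA : MeasurableSet A) : MeasurableSet (s ∩ f ⁻¹' A) := by
  have h := hs.subtype_image (hf.domRestrict.measurable hA)
  convert h using 1
  ext x
  simp [and_comm]

variable {n : ℕ} {X : Type*} [TopologicalSpace X] [ChartedSpace (RSpace n) X]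

/-- The derivative of the inverse chart is an isomorphism, so it carries the standard basis to a
basis, on which a nonzero alternating form of top degree cannot vanish. -/
theorem formCoeff_ne_zero (η : VolumeForm n X)
    {φ : OpenPartialHomeomorph X (RSpace n)} (hφ : φ ∈ IsManifold.maximalAtlas (𝓡 n) ∞ X)
    {y : RSpace n} (hy : y ∈ φ.target) : formCoeff η.form φ y ≠ 0 := by
  have hd : φ.MDifferentiable (𝓡 n) (𝓡 n) :=
    ⟨(contMDiffOn_of_mem_maximalAtlas hφ).mdifferentiableOn (by simp),
      (contMDiffOn_symm_of_mem_maximalAtlas hφ).mdifferentiableOn (by simp)⟩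
  let b : Module.Basis (Fin n) ℝ (TangentSpace (𝓡 n) (φ.symm y)) :=
    ((EuclideanSpace.basisFun (Fin n) ℝ).toBasis).map (hd.symm.mfderiv hy).toLinearEquiv
  have := (AlternatingMap.map_basis_ne_zero_iff b (η.form (φ.symm y))).2
    (η.nowhere_vanishing _)
  refine fun h => this ((congrArg (η.form (φ.symm y)) (funext fun i => ?_)).trans h)
  have hi : (EuclideanSpace.basisFun (Fin n) ℝ).toBasis i = EuclideanSpace.single i 1 := by simp
  exact (Module.Basis.map_apply _ _ i).trans
    (congrArg (mfderiv (𝓡 n) (𝓡 n) φ.symm y : RSpace n → _) hi)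

variable [MeasurableSpace X] [BorelSpace X] {O : OrientedAtlas n X} {η : VolumeForm n X}
  {μ : Measure X}

/-- The integral of a nowhere-zero density vanishes only over a Lebesgue null set. -/
theorem IsGivenByVolumeForm.volume_image_eq_zero (hη : IsGivenByVolumeForm O η μ)
    {φ : OpenPartialHomeomorph X (RSpace n)} (hφ : φ ∈ O.charts) {A : Set X}
    (hA : MeasurableSet A) (hAφ : A ⊆ φ.source) (h0 : μ A = 0) : volume (φ '' A) = 0 := by
  have hφ' := O.subset_maximalAtlas hφ
  have himg : φ '' A = φ.target ∩ φ.symm ⁻¹' A :=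
    φ.toPartialEquiv.image_eq_target_inter_inv_preimage hAφ
  have hm : MeasurableSet (φ '' A) := by
    rw [himg]
    exact φ.continuousOn_symm.measurableSet_inter_preimage φ.open_target.measurableSet hA
  have hsub : φ '' A ⊆ φ.target := himg ▸ Set.inter_subset_left
  rw [hη φ hφ A hA hAφ] at h0
  have hc : AEMeasurable (fun y => ‖formCoeff η.form φ y‖ₑ) (volume.restrict (φ '' A)) :=
    (((η.smooth φ hφ').continuousOn.mono hsub).aemeasurable hm).enorm
  rw [lintegral_eq_zero_iff' hc] at h0
  have h1 : ∀ᵐ y ∂(volume.restrict (φ '' A)), formCoeff η.form φ y ≠ 0 :=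
    ae_restrict_of_forall_mem hm fun y hy => formCoeff_ne_zero η hφ' (hsub hy)
  have h2 : ∀ᵐ y ∂(volume.restrict (φ '' A)), False := by
    filter_upwards [h0, h1] with y hy hy'
    exact hy' (by simpa using hy)
  simpa using h2

/-- Measurability of `A` is avoided by enlarging its chart image to a measurable null set, so that
the result applies to images under maps. -/
theorem IsGivenByVolumeForm.eq_zero_of_volume_image_eq_zero (hη : IsGivenByVolumeForm O η μ)
    {φ : OpenPartialHomeomorph X (RSpace n)} (hφ : φ ∈ O.charts) {A : Set X}
    (hAφ : A ⊆ φ.source) (h0 : volume (φ '' A) = 0) : μ A = 0 := by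
  obtain ⟨K, hAK, hK, hK0⟩ := exists_measurable_superset_of_null h0
  have hm : MeasurableSet (φ.source ∩ φ ⁻¹' K) :=
    φ.continuousOn.measurableSet_inter_preimage φ.open_source.measurableSet hK
  refine measure_mono_null (t := φ.source ∩ φ ⁻¹' K)
    (fun x hx => ⟨hAφ hx, hAK ⟨x, hx, rfl⟩⟩) ?_
  rw [hη φ hφ _ hm Set.inter_subset_left]
  have : volume (φ '' (φ.source ∩ φ ⁻¹' K)) = 0 :=
    measure_mono_null (by rintro _ ⟨x, hx, rfl⟩; exact hx.2) hK0
  rw [Measure.restrict_eq_zero.2 this, lintegral_zero_measure]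

/-- A differentiable map sends null sets of a measure given by a volume form to null sets. -/
theorem IsGivenByVolumeForm.image_eq_zero_of_mdifferentiableAt [SecondCountableTopology X]
    (hη : IsGivenByVolumeForm O η μ) {T : X → X} {N : Set X} (hN : MeasurableSet N)
    (hT : ∀ x ∈ N, ∃ U : Set X, IsOpen U ∧ x ∈ U ∧
      ∀ z ∈ U, MDifferentiableAt (𝓡 n) (𝓡 n) T z)
    (h0 : μ N = 0) : μ (T '' N) = 0 := by
  -- In charts `T` is a differentiable map between open parts of the same ℝⁿ, which preserves
  -- Lebesgue null sets; second countability reduces to countably many such pieces.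
  have hloc : ∀ x ∈ N, ∃ W ∈ 𝓝[N] x, μ (T '' (N ∩ W)) = 0 := by
    intro x hx
    obtain ⟨U, hU, hxU, hTU⟩ := hT x hx
    obtain ⟨φ, hφ, hxφ⟩ := O.covers x
    obtain ⟨ψ, hψ, hxψ⟩ := O.covers (T x)
    have hTc : ContinuousOn T U := fun z hz => (hTU z hz).continuousAt.continuousWithinAt
    let W := φ.source ∩ (U ∩ T ⁻¹' ψ.source)
    have hW : IsOpen W := φ.open_source.inter (hTc.isOpen_inter_preimage hU ψ.open_source)
    refine ⟨W, mem_nhdsWithin_of_mem_nhds (hW.mem_nhds ⟨hxφ, hxU, hxψ⟩), ?_⟩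
    have hA0 : volume (φ '' (N ∩ W)) = 0 :=
      hη.volume_image_eq_zero hφ (hN.inter hW.measurableSet) (fun z hz => hz.2.1)
        (measure_mono_null Set.inter_subset_left h0)
    refine hη.eq_zero_of_volume_image_eq_zero hψ ?_ ?_
    · rintro _ ⟨z, hz, rfl⟩
      exact hz.2.2.2
    have himg : ψ '' (T '' (N ∩ W)) = (ψ ∘ T ∘ φ.symm) '' (φ '' (N ∩ W)) := by
      simp only [Set.image_image, Function.comp_apply]
      refine Set.image_congr fun z hz => ?_
      rw [φ.left_inv hz.2.1]
    rw [himg]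
    refine addHaar_image_eq_zero_of_differentiableOn_of_addHaar_eq_zero _ ?_ hA0
    rintro _ ⟨z, hz, rfl⟩
    refine DifferentiableAt.differentiableWithinAt ?_
    rw [← mdifferentiableAt_iff_differentiableAt]
    have hφz : φ.symm (φ z) = z := φ.left_inv hz.2.1
    have h1 : MDifferentiableAt (𝓡 n) (𝓡 n) φ.symm (φ z) :=
      (contMDiffAt_symm_of_mem_maximalAtlas (O.subset_maximalAtlas hφ)
        (φ.map_source hz.2.1)).mdifferentiableAt (by simp)
    have h2 : MDifferentiableAt (𝓡 n) (𝓡 n) T (φ.symm (φ z)) := by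
      rw [hφz]
      exact hTU z hz.2.2.1
    have h3 : MDifferentiableAt (𝓡 n) (𝓡 n) ψ (T (φ.symm (φ z))) :=
      (contMDiffAt_of_mem_maximalAtlas (O.subset_maximalAtlas hψ)
        (hφz.symm ▸ hz.2.2.2)).mdifferentiableAt (by simp)
    exact MDifferentiableAt.comp (φ z) (f := T ∘ φ.symm) h3 (h2.comp _ h1)
  choose! W hW hW0 using hloc
  obtain ⟨c, hcN, hc, hcov⟩ := TopologicalSpace.countable_cover_nhdsWithin hW
  refine measure_mono_null (t := ⋃ x ∈ c, T '' (N ∩ W x)) ?_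
    ((measure_biUnion_null_iff hc).2 fun x hx => hW0 x (hcN hx))
  rintro _ ⟨z, hz, rfl⟩
  obtain ⟨x, hx, hzx⟩ := Set.mem_iUnion₂.1 (hcov hz)
  exact Set.mem_iUnion₂.2 ⟨x, hx, z, ⟨hz, hzx⟩, rfl⟩

end NullSets

/-! ### The orbit space and its measurable section. -/

namespace ClosedOrbitUnion

variable {G X : Type*} [Group G] [MulAction G X] [TopologicalSpace X]
  (Z : ClosedOrbitUnion G X)

theorem proj_eq_proj_iff {x y : Z.compl} : Z.proj x = Z.proj y ↔ ∃ g : G, g • y = x :=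
  Quotient.eq (r := MulAction.orbitRel G Z.compl)

theorem proj_smul (g : G) (x : Z.compl) : Z.proj (g • x) = Z.proj x :=
  Z.proj_eq_proj_iff.2 ⟨g, rfl⟩

/-- The quotient map of an action by homeomorphisms is open, so it carries a countable base to a
countable base. -/
theorem secondCountableTopology_orbitSpace [SecondCountableTopology X]
    [ContinuousConstSMul G Z.compl] : SecondCountableTopology Z.OrbitSpace := by
  have h : IsOpenQuotientMap (Quotient.mk (MulAction.orbitRel G Z.compl)) :=
    MulAction.isOpenQuotientMap_quotientMk
  exact h.isQuotientMap.secondCountableTopology h.isOpenMap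

theorem exists_measurable_section_proj [SecondCountableTopology X] [MeasurableSpace X]
    [BorelSpace X] [ContinuousConstSMul G Z.compl] {n : ℕ} [ChartedSpace (RSpace n) X]
    (hZ : Z.QuotientIsSmooth (n := n)) :
    ∃ s : Z.OrbitSpace → Z.compl, Measurable s ∧ ∀ y, Z.proj (s y) = y := by
  obtain ⟨_, m, _, _, hsub⟩ := hZ
  have := Z.secondCountableTopology_orbitSpace
  refine exists_measurable_section Z.proj fun y => ?_
  obtain ⟨x, rfl⟩ : ∃ x, Z.proj x = y := Quotient.exists_rep y
  exact (hsub.isSubmersionAt x).exists_continuousOn_section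

end ClosedOrbitUnion

theorem mainTheorem9 {n d : ℕ} {G X : Type*}
    [Group G] [TopologicalSpace G] [ChartedSpace (RSpace d) G] [LieGroup (𝓡 d) ∞ G]
    [IsTopologicalGroup G] [LocallyCompactSpace G] [SigmaCompactSpace G]
    [MeasurableSpace G] [BorelSpace G]
    [TopologicalSpace X] [PolishSpace X] [MeasurableSpace X] [BorelSpace X]
    [ChartedSpace (RSpace n) X] [IsManifold (𝓡 n) ∞ X]
    [MulAction G X]
    (μ : Measure X) [IsProbabilityMeasure μ]
    (O : OrientedAtlas n X) (η : VolumeForm n X) (hη : IsGivenByVolumeForm O η μ)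
    (hX₀ : ∃ Z : ClosedOrbitUnion G X, μ Z.carrier = 0 ∧ Z.ActsFreely ∧
      ContMDiff ((𝓡 d).prod (𝓡 n)) (𝓡 n) ∞ (fun p : G × Z.compl => p.1 • p.2) ∧
      Z.QuotientIsSmooth (n := n)) :
    OrbitRegular G μ := by
  obtain ⟨Z, hZ0, hfree, hsmooth, hquot⟩ := hX₀
  have : SecondCountableTopology G := ChartedSpace.secondCountable_of_sigmaCompact (RSpace d) G
  -- Charts give T1, and a T1 topological group is Hausdorff.
  have : T1Space G := ChartedSpace.t1Space (RSpace d) G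
  have : PolishSpace G := polishSpace_of_locallyCompact_group G
  have : PolishSpace Z.compl := Z.compl.isOpen.polishSpace
  have hcont : Continuous fun p : G × Z.compl => p.1 • p.2 := hsmooth.continuous
  have hsmul : ContinuousSMul G Z.compl := ⟨hcont⟩
  obtain ⟨s, hs, hsec⟩ := Z.exists_measurable_section_proj hquot
  have hproj : Continuous Z.proj := continuous_coinduced_rng
  have hemb : MeasurableEmbedding (Subtype.val : Z.compl → X) :=
    MeasurableEmbedding.subtype_coe Z.compl.isOpen.measurableSet
  have : IsFiniteMeasure (μ.comap (Subtype.val : Z.compl → X)) :=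
    ⟨by rw [hemb.comap_apply]; exact measure_lt_top _ _⟩
  have hqi : ∀ (g : G) (E : Set Z.compl), MeasurableSet E →
      μ.comap (Subtype.val : Z.compl → X) E = 0 →
      μ.comap (Subtype.val : Z.compl → X) ((g • ·) ⁻¹' E) = 0 := by
    intro g E hE h0
    rw [hemb.comap_apply] at h0 ⊢
    -- Turns the preimage under `g` into an image under `g⁻¹`, to which the null-set theorem for
    -- images applies.
    have himg : Subtype.val '' ((g • ·) ⁻¹' E) = (fun x : X => g⁻¹ • x) '' (Subtype.val '' E) := by
      ext x
      constructor
      · rintro ⟨z, hz, rfl⟩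
        exact ⟨g • z, ⟨g • z, hz, rfl⟩, congrArg Subtype.val (inv_smul_smul g z)⟩
      · rintro ⟨_, ⟨z, hz, rfl⟩, rfl⟩
        exact ⟨g⁻¹ • z, by simpa using hz, rfl⟩
    rw [himg]
    refine hη.image_eq_zero_of_mdifferentiableAt (hemb.measurableSet_image.2 hE) ?_ h0
    rintro _ ⟨x, hx, rfl⟩
    -- Smoothness of the action is known only off X₀, so differentiability is claimed only on this
    -- open set.
    refine ⟨Z.compl, Z.compl.isOpen, x.2, fun z hz => ?_⟩
    have h1 : ContMDiff (𝓡 n) (𝓡 n) ∞ fun x : Z.compl => ((g⁻¹ • x : Z.compl) : X) :=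
      contMDiff_subtype_val.comp (hsmooth.comp (contMDiff_const.prodMk contMDiff_id))
    have h2 : ContMDiffAt (𝓡 n) (𝓡 n) ∞ (fun x : X => g⁻¹ • x) ((⟨z, hz⟩ : Z.compl) : X) :=
      contMDiffAt_subtype_iff.1 (h1 ⟨z, hz⟩)
    exact h2.mdifferentiableAt (by simp)
  exact ⟨Z, hZ0, hfree, exists_isDisintegration_of_section hcont.measurable hproj.measurable hs
    hsec Z.proj_smul (fun x => Z.proj_eq_proj_iff.1 (hsec (Z.proj x)).symm) hfree _ hqi⟩
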